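/- Let $A$ be an associative ring with unit. An $A$-coring $\mathfrak C$ is an $A$-bimodule with $A$-bilinear maps $\Delta:\mathfrak C\to\mathfrak C\otimes_A\mathfrak C$ (coassociative) and $\varepsilon:\mathfrak C\to A$ (a counit for $\Delta$). A right $\mathfrak C$-comodule is a right $A$-module $M$ with a right $A$-linear map $\rho_M:M\to M\otimes_A\mathfrak C$, $\rho_M(m)=m_{[0]}\otimes_A m_{[1]}$ (summation understood), such that $(\rho_M\otimes_A\mathfrak C)\circ\rho_M=(M\otimes_A\Delta)\circ\rho_M$ and $(M\otimes_A\varepsilon)\circ\rho_M=\mathrm{id}_M$. A right $A$-linear map $f:M\to N$ between comodules is colinear if $\rho_N\circ f=(f\otimes_A\mathfrak C)\circ\rho_M$; $\mathrm{Hom}^{\mathfrak C}(M,N)$ denotes the group of colinear maps. A comodule $N$ is $(\mathfrak C,A)$-injective if for every colinear map $i:K\to L$ that has a right $A$-linear left inverse, every colinear map $K\to N$ factors through $i$ by a colinear map $L\to N$. A ring $R$, not necessarily with unit, is firm if the multiplication map $R\otimes_R R\to R$ is an isomorphism, and a left $R$-module $\Sigma$ is firm if $R\otimes_R\Sigma\to\Sigma$,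 $r\otimes u\mapsto ru$, is an isomorphism. **Theorem.** Let $R$ be a firm ring, $\mathfrak C$ an $A$-coring, and $\Sigma$ an $R$-$A$-bimodule that is firm as a left $R$-module and carries a right $\mathfrak C$-comodule structure with left $R$-linear coaction $\rho_\Sigma$. Let $R$ act from the right on $\mathrm{Hom}_A(\Sigma,M)$ and on $\mathrm{Hom}^{\mathfrak C}(\Sigma,N)$ by $(fr)(u)=f(ru)$. The following are equivalent. 1. $\Sigma$ is an $R$-$\mathfrak C$ comonadic-Galois comodule, i.e. for every right $A$-module $M$ the map $$\mathrm{can}_M:\mathrm{Hom}_A(\Sigma,M)\otimes_R\Sigma\to M\otimes_A\mathfrak C,\qquad \mathrm{can}_M(f\otimes_R u)=f(u_{[0]})\otimes_A u_{[1]}$$ is an isomorphism. 2. For every $(\mathfrak C,A)$-injective right $\mathfrak C$-comodule $N$ the evaluation map $$\mathrm{ev}_N:\mathrm{Hom}^{\mathfrak C}(\Sigma,N)\otimes_R\Sigma\to N,\qquad \mathrm{ev}_N(f\otimes_R u)=f(u)$$ is an isomorphism. -/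

import Mathlib

open scoped TensorProduct
open MulOpposite

universe u

/-- Module laws for a ring without unit: the action of `R` on the abelian group `M` is additive in
both variables and associative. A left `R`-module is an abelian group with such an action. -/
class IsNonUnitalModule (R M : Type*) [NonUnitalRing R] [AddCommGroup M] [DistribSMul R M] :
    Prop where
  add_smul' : ∀ (r s : R) (m : M), (r + s) • m = r • m + s • m
  mul_smul' : ∀ (r s : R) (m : M), (r * s) • m = r • (s • m)

instance IsNonUnitalModule.ofModule (A M : Type*) [Ring A] [AddCommGroup M] [Module A M] :
    IsNonUnitalModule A M where
  add_smul' := add_smul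
  mul_smul' := mul_smul

instance IsNonUnitalModule.self (R : Type*) [NonUnitalRing R] : IsNonUnitalModule R R where
  add_smul' := add_mul
  mul_smul' := mul_assoc

/-- The subgroup of `M ⊗ N` (tensor product of abelian groups) generated by the elements
`m s ⊗ n - m ⊗ s n`. -/
def balancedRelations (S M N : Type*) [AddCommGroup M] [AddCommGroup N] [SMul Sᵐᵒᵖ M] [SMul S N] :
    AddSubgroup (M ⊗[ℤ] N) :=
  AddSubgroup.closure {x | ∃ (m : M) (s : S) (n : N), x = (op s • m) ⊗ₜ[ℤ] n - m ⊗ₜ[ℤ] (s • n)}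

/-- The tensor product `M ⊗_S N` of a right `S`-module `M` and a left `S`-module `N`, for a not
necessarily commutative, not necessarily unital ring `S`. Right actions of `S` are actions of
`Sᵐᵒᵖ`. -/
def BalTensor (S M N : Type*) [AddCommGroup M] [AddCommGroup N] [SMul Sᵐᵒᵖ M] [SMul S N] :
    Type _ :=
  (M ⊗[ℤ] N) ⧸ balancedRelations S M N

namespace BalTensor

section Basic

variable {S M N P : Type*} [AddCommGroup M] [AddCommGroup N] [AddCommGroup P]
  [SMul Sᵐᵒᵖ M] [SMul S N]

instance : AddCommGroup (BalTensor S M N) :=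
  inferInstanceAs (AddCommGroup ((M ⊗[ℤ] N) ⧸ balancedRelations S M N))

/-- The pure tensor `m ⊗ n` in `M ⊗_S N`. -/
def tmul (S : Type*) {M N : Type*} [AddCommGroup M] [AddCommGroup N] [SMul Sᵐᵒᵖ M] [SMul S N]
    (m : M) (n : N) : BalTensor S M N :=
  QuotientAddGroup.mk' (balancedRelations S M N) (m ⊗ₜ[ℤ] n)

theorem add_tmul (m m' : M) (n : N) : tmul S (m + m') n = tmul S m n + tmul S m' n := by
  simp only [tmul, TensorProduct.add_tmul]
  exact map_add (QuotientAddGroup.mk' (balancedRelations S M N)) _ _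

theorem tmul_add (m : M) (n n' : N) : tmul S m (n + n') = tmul S m n + tmul S m n' := by
  simp only [tmul, TensorProduct.tmul_add]
  exact map_add (QuotientAddGroup.mk' (balancedRelations S M N)) _ _

theorem smul_tmul (s : S) (m : M) (n : N) : tmul S (op s • m) n = tmul S m (s • n) := by
  refine (QuotientAddGroup.eq_iff_sub_mem).2 ?_
  exact AddSubgroup.subset_closure ⟨m, s, n, rfl⟩

/-- The universal property: a biadditive balanced map factors through `M ⊗_S N`. -/
def lift (f : M →+ N →+ P) (hf : ∀ (s : S) (m : M) (n : N), f (op s • m) n = f m (s • n)) :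
    BalTensor S M N →+ P :=
  QuotientAddGroup.lift (balancedRelations S M N)
    (TensorProduct.liftAddHom f (fun k m n => by simp))
    (by
      refine (AddSubgroup.closure_le _).2 ?_
      rintro x ⟨m, s, n, rfl⟩
      simp [hf])

@[simp]
theorem lift_tmul (f : M →+ N →+ P)
    (hf : ∀ (s : S) (m : M) (n : N), f (op s • m) n = f m (s • n)) (m : M) (n : N) :
    lift f hf (tmul S m n) = f m n := rfl

theorem induction {p : BalTensor S M N → Prop} (x : BalTensor S M N) (zero : p 0)
    (pure : ∀ m n, p (tmul S m n)) (add : ∀ x y, p x → p y → p (x + y)) : p x := by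
  obtain ⟨y, rfl⟩ := QuotientAddGroup.mk_surjective x
  induction y using TensorProduct.induction_on with
  | zero => exact zero
  | tmul m n => exact pure m n
  | add a b ha hb => exact add _ _ ha hb

theorem hom_ext {f g : BalTensor S M N →+ P} (h : ∀ m n, f (tmul S m n) = g (tmul S m n)) :
    f = g := by
  ext x
  induction x using induction with
  | zero => simp
  | pure m n => exact h m n
  | add x y hx hy => simp [hx, hy]

/-- The pure tensor as a biadditive map. -/
def mk (S M N : Type*) [AddCommGroup M] [AddCommGroup N] [SMul Sᵐᵒᵖ M] [SMul S N] :
    M →+ N →+ BalTensor S M N :=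
  AddMonoidHom.mk' (fun m => AddMonoidHom.mk' (fun n => tmul S m n) (tmul_add m))
    (fun m m' => by ext n; exact add_tmul m m' n)

@[simp]
theorem mk_apply (m : M) (n : N) : mk S M N m n = tmul S m n := rfl

/-- `f ⊗ g : M ⊗_S N → M' ⊗_S N'` for a right `S`-linear `f` and a left `S`-linear `g`. -/
def map {M' N' : Type*} [AddCommGroup M'] [AddCommGroup N'] [SMul Sᵐᵒᵖ M'] [SMul S N']
    (f : M →+ M') (hf : ∀ (s : S) m, f (op s • m) = op s • f m)
    (g : N →+ N') (hg : ∀ (s : S) n, g (s • n) = s • g n) :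
    BalTensor S M N →+ BalTensor S M' N' :=
  lift (((mk S M' N').comp f).compl₂ g) (fun s m n => by simp [hf, hg, smul_tmul])

@[simp]
theorem map_tmul {M' N' : Type*} [AddCommGroup M'] [AddCommGroup N'] [SMul Sᵐᵒᵖ M'] [SMul S N']
    (f : M →+ M') (hf : ∀ (s : S) m, f (op s • m) = op s • f m)
    (g : N →+ N') (hg : ∀ (s : S) n, g (s • n) = s • g n) (m : M) (n : N) :
    map f hf g hg (tmul S m n) = tmul S (f m) (g n) := rfl

end Basic

section LeftAction

variable {S T M N : Type*} [AddCommGroup M] [AddCommGroup N] [SMul Sᵐᵒᵖ M] [SMul S N]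

/-- A left action on `M` commuting with the right `S`-action gives a left action on `M ⊗_S N`:
`t (m ⊗ n) = t m ⊗ n`. -/
instance leftDistribSMul [DistribSMul T M] [SMulCommClass T Sᵐᵒᵖ M] :
    DistribSMul T (BalTensor S M N) where
  smul t := map (DistribSMul.toAddMonoidHom M t) (fun s m => smul_comm t (op s) m)
    (AddMonoidHom.id N) (fun _ _ => rfl)
  smul_zero _ := map_zero _
  smul_add _ := map_add _

theorem left_smul_tmul [DistribSMul T M] [SMulCommClass T Sᵐᵒᵖ M] (t : T) (m : M) (n : N) :
    t • tmul S m n = tmul S (t • m) n := rfl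

instance leftModule [Ring T] [Module T M] [SMulCommClass T Sᵐᵒᵖ M] :
    Module T (BalTensor S M N) where
  __ := leftDistribSMul
  one_smul x := by
    induction x using induction with
    | zero => exact smul_zero _
    | pure m n => rw [left_smul_tmul, one_smul]
    | add x y hx hy => rw [smul_add, hx, hy]
  mul_smul a b x := by
    induction x using induction with
    | zero => simp only [smul_zero]
    | pure m n => simp only [left_smul_tmul, mul_smul]
    | add x y hx hy => simp only [smul_add, hx, hy]
  add_smul a b x := by
    induction x using induction with
    | zero => simp only [smul_zero, add_zero]
    | pure m n => simp only [left_smul_tmul, add_smul, add_tmul]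
    | add x y hx hy => simp only [smul_add, hx, hy]; abel
  zero_smul x := by
    induction x using induction with
    | zero => exact smul_zero _
    | pure m n => rw [left_smul_tmul, zero_smul]; exact map_zero ((mk S M N).flip n)
    | add x y hx hy => rw [smul_add, hx, hy, add_zero]

end LeftAction

section RightAction

variable {S T M N : Type*} [AddCommGroup M] [AddCommGroup N] [SMul Sᵐᵒᵖ M] [SMul S N]

/-- A right action on `N` commuting with the left `S`-action gives a right action on `M ⊗_S N`:
`(m ⊗ n) t = m ⊗ n t`. -/
instance rightDistribSMul [DistribSMul Tᵐᵒᵖ N] [SMulCommClass S Tᵐᵒᵖ N] :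
    DistribSMul Tᵐᵒᵖ (BalTensor S M N) where
  smul t := map (AddMonoidHom.id M) (fun _ _ => rfl) (DistribSMul.toAddMonoidHom N t)
    (fun s n => (smul_comm s t n).symm)
  smul_zero _ := map_zero _
  smul_add _ := map_add _

theorem right_smul_tmul [DistribSMul Tᵐᵒᵖ N] [SMulCommClass S Tᵐᵒᵖ N] (t : Tᵐᵒᵖ) (m : M)
    (n : N) : t • tmul S m n = tmul S m (t • n) := rfl

instance rightModule [Ring T] [Module Tᵐᵒᵖ N] [SMulCommClass S Tᵐᵒᵖ N] :
    Module Tᵐᵒᵖ (BalTensor S M N) where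
  __ := rightDistribSMul
  one_smul x := by
    induction x using induction with
    | zero => exact smul_zero _
    | pure m n => rw [right_smul_tmul, one_smul]
    | add x y hx hy => rw [smul_add, hx, hy]
  mul_smul a b x := by
    induction x using induction with
    | zero => simp only [smul_zero]
    | pure m n => simp only [right_smul_tmul, mul_smul]
    | add x y hx hy => simp only [smul_add, hx, hy]
  add_smul a b x := by
    induction x using induction with
    | zero => simp only [smul_zero, add_zero]
    | pure m n => simp only [right_smul_tmul, add_smul, tmul_add]
    | add x y hx hy => simp only [smul_add, hx, hy]; abel
  zero_smul x := by
    induction x using induction with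
    | zero => exact smul_zero _
    | pure m n => rw [right_smul_tmul, zero_smul]; exact map_zero (mk S M N m)
    | add x y hx hy => rw [smul_add, hx, hy, add_zero]

end RightAction

section Assoc

variable (A M C D : Type*) [Ring A] [AddCommGroup M] [Module Aᵐᵒᵖ M] [AddCommGroup C] [Module A C]
  [Module Aᵐᵒᵖ C] [SMulCommClass A Aᵐᵒᵖ C] [AddCommGroup D] [Module A D]

/-- The map `(M ⊗_A C) ⊗_A D → M ⊗_A (C ⊗_A D)`, `(m ⊗ c) ⊗ d ↦ m ⊗ (c ⊗ d)`. -/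
def assocHom : BalTensor A (BalTensor A M C) D →+ BalTensor A M (BalTensor A C D) :=
  lift
    (lift
      (AddMonoidHom.mk' (fun m => (AddMonoidHom.compHom (mk A M (BalTensor A C D) m)).comp
        (mk A C D)) (fun m m' => by ext c d; exact add_tmul _ _ _))
      (fun a m c => by ext d; exact smul_tmul a m (tmul A c d)))
    (fun a x d => by
      induction x using induction with
      | zero => simp
      | pure m c =>
        change tmul A m (tmul A (op a • c) d) = tmul A m (tmul A c (a • d))
        rw [smul_tmul]
      | add x y hx hy => simp only [smul_add, map_add, AddMonoidHom.add_apply, hx, hy])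

@[simp]
theorem assocHom_tmul (m : M) (c : C) (d : D) :
    assocHom A M C D (tmul A (tmul A m c) d) = tmul A m (tmul A c d) := rfl

/-- The map `M ⊗_A (C ⊗_A D) → (M ⊗_A C) ⊗_A D`, `m ⊗ (c ⊗ d) ↦ (m ⊗ c) ⊗ d`. -/
def assocInv : BalTensor A M (BalTensor A C D) →+ BalTensor A (BalTensor A M C) D :=
  lift
    (AddMonoidHom.mk' (fun m => lift ((mk A (BalTensor A M C) D).comp (mk A M C m))
        (fun a c d => smul_tmul a (tmul A m c) d))
      (fun m m' => hom_ext fun c d => by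
        change tmul A (tmul A (m + m') c) d = tmul A (tmul A m c) d + tmul A (tmul A m' c) d
        rw [add_tmul, add_tmul]))
    (fun a m x => by
      induction x using induction with
      | zero => simp
      | pure c d =>
        change tmul A (tmul A (op a • m) c) d = tmul A (tmul A m (a • c)) d
        rw [smul_tmul]
      | add x y hx hy => simp only [smul_add, map_add, hx, hy])

@[simp]
theorem assocInv_tmul (m : M) (c : C) (d : D) :
    assocInv A M C D (tmul A m (tmul A c d)) = tmul A (tmul A m c) d := rfl

theorem assocInv_assocHom (x : BalTensor A (BalTensor A M C) D) :
    assocInv A M C D (assocHom A M C D x) = x := by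
  induction x using induction with
  | zero => rw [map_zero, map_zero]
  | pure x d =>
    induction x using induction with
    | zero =>
      rw [show tmul A (0 : BalTensor A M C) d = 0 from
        map_zero ((mk A (BalTensor A M C) D).flip d), map_zero, map_zero]
    | pure m c => rw [assocHom_tmul, assocInv_tmul]
    | add x y hx hy => rw [add_tmul, map_add, map_add, hx, hy]
  | add x y hx hy => rw [map_add, map_add, hx, hy]

theorem assocHom_assocInv (x : BalTensor A M (BalTensor A C D)) :
    assocHom A M C D (assocInv A M C D x) = x := by
  induction x using induction with
  | zero => rw [map_zero, map_zero]
  | pure m x =>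
    induction x using induction with
    | zero =>
      rw [show tmul A m (0 : BalTensor A C D) = 0 from
        map_zero (mk A M (BalTensor A C D) m), map_zero, map_zero]
    | pure c d => rw [assocInv_tmul, assocHom_tmul]
    | add x y hx hy => rw [tmul_add, map_add, map_add, hx, hy]
  | add x y hx hy => rw [map_add, map_add, hx, hy]

/-- The canonical isomorphism `(M ⊗_A C) ⊗_A D → M ⊗_A (C ⊗_A D)`,
`(m ⊗ c) ⊗ d ↦ m ⊗ (c ⊗ d)`. -/
def assoc : BalTensor A (BalTensor A M C) D ≃+ BalTensor A M (BalTensor A C D) where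
  toFun := assocHom A M C D
  invFun := assocInv A M C D
  left_inv := assocInv_assocHom A M C D
  right_inv := assocHom_assocInv A M C D
  map_add' := map_add _

@[simp]
theorem assoc_tmul (m : M) (c : C) (d : D) :
    assoc A M C D (tmul A (tmul A m c) d) = tmul A m (tmul A c d) := rfl

end Assoc

/-- The multiplication map `R ⊗_R M → M`, `r ⊗ m ↦ r m`. -/
def leftAct (R M : Type*) [NonUnitalRing R] [AddCommGroup M] [DistribSMul R M]
    [IsNonUnitalModule R M] : BalTensor R R M →+ M :=
  lift (AddMonoidHom.mk' (fun r => DistribSMul.toAddMonoidHom M r)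
      (fun r s => by ext m; exact IsNonUnitalModule.add_smul' r s m))
    (fun s r m => IsNonUnitalModule.mul_smul' r s m)

/-- The multiplication map `M ⊗_A A → M`, `m ⊗ a ↦ m a`. -/
def rightAct (A M : Type*) [Ring A] [AddCommGroup M] [Module Aᵐᵒᵖ M] : BalTensor A M A →+ M :=
  lift (AddMonoidHom.mk' (fun m => AddMonoidHom.mk' (fun a : A => op a • m)
        (fun a b => by rw [op_add, add_smul]))
      (fun m m' => by ext a; exact smul_add _ _ _))
    (fun s m a => by simp [mul_smul])

end BalTensor

/-- A left `R`-module is firm if the multiplication map `R ⊗_R M → M` is an isomorphism. -/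
def IsFirmModule (R M : Type*) [NonUnitalRing R] [AddCommGroup M] [DistribSMul R M]
    [IsNonUnitalModule R M] : Prop :=
  Function.Bijective (BalTensor.leftAct R M)

/-- A ring `R`, not necessarily with unit, is firm if the multiplication map `R ⊗_R R → R` is an
isomorphism. -/
def IsFirmRing (R : Type*) [NonUnitalRing R] : Prop :=
  IsFirmModule R R

/-- An `A`-coring structure on the `A`-bimodule `C`: `A`-bilinear maps `Δ : C → C ⊗_A C` and
`ε : C → A` that are coassociative and counital. -/
structure Coring (A C : Type*) [Ring A] [AddCommGroup C] [Module A C] [Module Aᵐᵒᵖ C]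
    [SMulCommClass A Aᵐᵒᵖ C] where
  comul : C →ₗ[Aᵐᵒᵖ] BalTensor A C C
  comul_smul : ∀ (a : A) (c : C), comul (a • c) = a • comul c
  counit : C →ₗ[Aᵐᵒᵖ] A
  counit_smul : ∀ (a : A) (c : C), counit (a • c) = a • counit c
  coassoc : ∀ c : C,
    BalTensor.assoc A C C C
        (BalTensor.map comul.toAddMonoidHom (fun a c => comul.map_smul (op a) c)
          (AddMonoidHom.id C) (fun _ _ => rfl) (comul c))
      = BalTensor.map (AddMonoidHom.id C) (fun _ _ => rfl) comul.toAddMonoidHom comul_smul (comul c)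
  counit_comul : ∀ c : C,
    BalTensor.leftAct A C
        (BalTensor.map counit.toAddMonoidHom (fun a c => counit.map_smul (op a) c)
          (AddMonoidHom.id C) (fun _ _ => rfl) (comul c)) = c
  comul_counit : ∀ c : C,
    BalTensor.rightAct A C
        (BalTensor.map (AddMonoidHom.id C) (fun _ _ => rfl) counit.toAddMonoidHom counit_smul
          (comul c)) = c

section Comodules

variable {A C : Type*} [Ring A] [AddCommGroup C] [Module A C] [Module Aᵐᵒᵖ C]
  [SMulCommClass A Aᵐᵒᵖ C]

/-- `f ⊗ C : M ⊗_A C → N ⊗_A C` for a right `A`-linear map `f`. -/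
def tensorRight {M N : Type*} [AddCommGroup M] [Module Aᵐᵒᵖ M] [AddCommGroup N] [Module Aᵐᵒᵖ N]
    (f : M →ₗ[Aᵐᵒᵖ] N) : BalTensor A M C →ₗ[Aᵐᵒᵖ] BalTensor A N C where
  __ := BalTensor.map f.toAddMonoidHom (fun a m => f.map_smul (op a) m) (AddMonoidHom.id C)
    (fun _ _ => rfl)
  map_smul' a x := by
    change BalTensor.map _ _ _ _ (a • x) = a • BalTensor.map _ _ _ _ x
    induction x using BalTensor.induction with
    | zero => simp only [smul_zero, map_zero]
    | pure m c => rfl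
    | add x y hx hy => simp only [smul_add, map_add, hx, hy]

@[simp]
theorem tensorRight_tmul {M N : Type*} [AddCommGroup M] [Module Aᵐᵒᵖ M] [AddCommGroup N]
    [Module Aᵐᵒᵖ N] (f : M →ₗ[Aᵐᵒᵖ] N) (m : M) (c : C) :
    tensorRight f (BalTensor.tmul A m c) = BalTensor.tmul A (f m) c := rfl

theorem tensorRight_add {M N : Type*} [AddCommGroup M] [Module Aᵐᵒᵖ M] [AddCommGroup N]
    [Module Aᵐᵒᵖ N] (f g : M →ₗ[Aᵐᵒᵖ] N) (x : BalTensor A M C) :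
    tensorRight (f + g) x = tensorRight f x + tensorRight g x := by
  induction x using BalTensor.induction with
  | zero => simp only [map_zero, add_zero]
  | pure m c => simp only [tensorRight_tmul, LinearMap.add_apply, BalTensor.add_tmul]
  | add x y hx hy => simp only [map_add, hx, hy]; abel

/-- A right `𝒞`-comodule structure on the right `A`-module `M`. -/
structure Comodule (𝒞 : Coring A C) (M : Type*) [AddCommGroup M] [Module Aᵐᵒᵖ M] where
  coact : M →ₗ[Aᵐᵒᵖ] BalTensor A M C
  coassoc : ∀ m : M,
    BalTensor.assoc A M C C (tensorRight coact (coact m))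
      = BalTensor.map (AddMonoidHom.id M) (fun _ _ => rfl) 𝒞.comul.toAddMonoidHom 𝒞.comul_smul
          (coact m)
  counit : ∀ m : M,
    BalTensor.rightAct A M
        (BalTensor.map (AddMonoidHom.id M) (fun _ _ => rfl) 𝒞.counit.toAddMonoidHom 𝒞.counit_smul
          (coact m)) = m

/-- A right `A`-linear map is right `𝒞`-colinear if `ρ_N ∘ f = (f ⊗ C) ∘ ρ_M`. -/
def IsColinear {𝒞 : Coring A C} {M N : Type*} [AddCommGroup M] [Module Aᵐᵒᵖ M] [AddCommGroup N]
    [Module Aᵐᵒᵖ N] (ρM : Comodule 𝒞 M) (ρN : Comodule 𝒞 N) (f : M →ₗ[Aᵐᵒᵖ] N) : Prop :=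
  ∀ m : M, ρN.coact (f m) = tensorRight f (ρM.coact m)

/-- Left `R`-module structure compatible with a right `𝒞`-comodule structure on the
`R`-`A`-bimodule `S`: the coaction is left `R`-linear. -/
structure Bicomodule (R : Type*) [NonUnitalRing R] (𝒞 : Coring A C) (S : Type*) [AddCommGroup S]
    [Module Aᵐᵒᵖ S] [DistribSMul R S] [IsNonUnitalModule R S] [SMulCommClass R Aᵐᵒᵖ S] extends
    Comodule 𝒞 S where
  coact_smul : ∀ (r : R) (u : S), coact (r • u) = r • coact u

/-- `Hom^𝒞(M, N)`, right `𝒞`-colinear maps, as a subgroup of the right `A`-linear maps. -/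
def Comodule.colinearMaps {𝒞 : Coring A C} {M N : Type*} [AddCommGroup M] [Module Aᵐᵒᵖ M]
    [AddCommGroup N] [Module Aᵐᵒᵖ N] (ρM : Comodule 𝒞 M) (ρN : Comodule 𝒞 N) :
    AddSubgroup (M →ₗ[Aᵐᵒᵖ] N) where
  carrier := {f | IsColinear ρM ρN f}
  zero_mem' m := by
    have h := tensorRight_add (0 : M →ₗ[Aᵐᵒᵖ] N) 0 (ρM.coact m)
    rw [add_zero, left_eq_add] at h
    rw [h, LinearMap.zero_apply, map_zero]
  add_mem' {f g} hf hg m := by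
    rw [tensorRight_add, LinearMap.add_apply, map_add, hf m, hg m]
  neg_mem' {f} hf m := by
    have h := tensorRight_add f (-f) (ρM.coact m)
    have h0 := tensorRight_add (0 : M →ₗ[Aᵐᵒᵖ] N) 0 (ρM.coact m)
    rw [add_zero, left_eq_add] at h0
    rw [add_neg_cancel, h0] at h
    rw [LinearMap.neg_apply, map_neg, hf m, neg_eq_iff_add_eq_zero, ← h]

section BimoduleActions

variable {R S M : Type*} [NonUnitalRing R] [AddCommGroup S] [Module Aᵐᵒᵖ S] [DistribSMul R S]
  [IsNonUnitalModule R S] [SMulCommClass R Aᵐᵒᵖ S] [AddCommGroup M] [Module Aᵐᵒᵖ M]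

/-- `Hom_A(S, M)`, the group of right `A`-linear maps from the `R`-`A`-bimodule `S` to `M`. -/
def HomA (A S M : Type*) [Ring A] [AddCommGroup S] [Module Aᵐᵒᵖ S] [AddCommGroup M]
    [Module Aᵐᵒᵖ M] : Type _ :=
  S →ₗ[Aᵐᵒᵖ] M

instance : AddCommGroup (HomA A S M) :=
  inferInstanceAs (AddCommGroup (S →ₗ[Aᵐᵒᵖ] M))

/-- Precomposition with the action of `r` on `S`: the map `f r : u ↦ f (r u)`. -/
def precompSMul (r : R) (f : S →ₗ[Aᵐᵒᵖ] M) : S →ₗ[Aᵐᵒᵖ] M where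
  toFun u := f (r • u)
  map_add' u v := by rw [smul_add, map_add]
  map_smul' a u := by rw [smul_comm, map_smul, RingHom.id_apply]

theorem tensorRight_precompSMul (r : R) (f : S →ₗ[Aᵐᵒᵖ] M) (x : BalTensor A S C) :
    tensorRight (precompSMul r f) x = tensorRight f (r • x) := by
  induction x using BalTensor.induction with
  | zero => simp only [smul_zero, map_zero]
  | pure m c => rfl
  | add x y hx hy => simp only [smul_add, map_add, hx, hy]

/-- The right `R`-action `(f r)(u) = f (r u)` on `Hom_A(S, M)`. -/
instance HomA.instSMul : SMul Rᵐᵒᵖ (HomA A S M) where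
  smul r f := precompSMul (unop r) f

/-- `Hom^𝒞(S, N)`, the group of right `𝒞`-colinear maps from the bicomodule `S` to `N`. -/
def HomC {𝒞 : Coring A C} (σ : Bicomodule R 𝒞 S) (ρ : Comodule 𝒞 M) : Type _ :=
  σ.toComodule.colinearMaps ρ

instance {𝒞 : Coring A C} (σ : Bicomodule R 𝒞 S) (ρ : Comodule 𝒞 M) : AddCommGroup (HomC σ ρ) :=
  inferInstanceAs (AddCommGroup (σ.toComodule.colinearMaps ρ))

/-- The right `R`-action `(f r)(u) = f (r u)` on `Hom^𝒞(S, N)`. -/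
instance HomC.instSMul {𝒞 : Coring A C} (σ : Bicomodule R 𝒞 S) (ρ : Comodule 𝒞 M) :
    SMul Rᵐᵒᵖ (HomC σ ρ) where
  smul r f := ⟨precompSMul (unop r) f.1, fun u => by
    rw [tensorRight_precompSMul, ← σ.coact_smul]
    exact f.2 (unop r • u)⟩

/-- The canonical map `can_M : Hom_A(S, M) ⊗_R S → M ⊗_A C`, `f ⊗ u ↦ f(u_[0]) ⊗ u_[1]`, as a map
of right `A`-modules. -/
def can {𝒞 : Coring A C} (σ : Bicomodule R 𝒞 S) (M : Type*) [AddCommGroup M] [Module Aᵐᵒᵖ M] :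
    BalTensor R (HomA A S M) S →ₗ[Aᵐᵒᵖ] BalTensor A M C where
  __ := BalTensor.lift
    (AddMonoidHom.mk' (fun f : HomA A S M =>
        ((tensorRight (f : S →ₗ[Aᵐᵒᵖ] M)).comp σ.coact).toAddMonoidHom)
      (fun f g => by ext u; exact tensorRight_add f g (σ.coact u)))
    (fun r f u => by
      exact (tensorRight_precompSMul r f (σ.coact u)).trans
        (congrArg (tensorRight (f : S →ₗ[Aᵐᵒᵖ] M)) (σ.coact_smul r u).symm))
  map_smul' a x := by
    change BalTensor.lift _ _ (a • x) = a • BalTensor.lift _ _ x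
    induction x using BalTensor.induction with
    | zero => simp only [smul_zero, map_zero]
    | pure f u =>
      change tensorRight f (σ.coact (a • u)) = a • tensorRight f (σ.coact u)
      rw [map_smul, map_smul]
    | add x y hx hy => simp only [smul_add, map_add, hx, hy]

/-- The evaluation map `ev_N : Hom^𝒞(S, N) ⊗_R S → N`, `f ⊗ u ↦ f(u)`, as a map of right
`A`-modules. -/
def ev {𝒞 : Coring A C} (σ : Bicomodule R 𝒞 S) (ρ : Comodule 𝒞 M) :
    BalTensor R (HomC σ ρ) S →ₗ[Aᵐᵒᵖ] M where
  __ := BalTensor.lift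
    (AddMonoidHom.mk' (fun f : HomC σ ρ => f.1.toAddMonoidHom) (fun f g => rfl))
    (fun r f u => rfl)
  map_smul' a x := by
    change BalTensor.lift _ _ (a • x) = a • BalTensor.lift _ _ x
    induction x using BalTensor.induction with
    | zero => simp only [smul_zero, map_zero]
    | pure f u => exact f.1.map_smul a u
    | add x y hx hy => simp only [smul_add, map_add, hx, hy]

@[simp]
theorem can_tmul {𝒞 : Coring A C} (σ : Bicomodule R 𝒞 S) (f : HomA A S M) (u : S) :
    can σ M (BalTensor.tmul R f u) = tensorRight (f : S →ₗ[Aᵐᵒᵖ] M) (σ.coact u) := rfl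

@[simp]
theorem ev_tmul {𝒞 : Coring A C} (σ : Bicomodule R 𝒞 S) (ρ : Comodule 𝒞 M) (f : HomC σ ρ) (u : S) :
    ev σ ρ (BalTensor.tmul R f u) = f.1 u := rfl

end BimoduleActions

end Comodules

section Galois

/-- The comodule `N` is `(𝒞, A)`-injective: for every colinear `i : K → L` that is a split
monomorphism of right `A`-modules, every colinear `f : K → N` extends along `i` to a colinear
`g : L → N`. -/
def IsRelInjective {A C : Type u} [Ring A] [AddCommGroup C] [Module A C] [Module Aᵐᵒᵖ C]
    [SMulCommClass A Aᵐᵒᵖ C] {𝒞 : Coring A C} {N : Type u} [AddCommGroup N] [Module Aᵐᵒᵖ N]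
    (ρN : Comodule 𝒞 N) : Prop :=
  ∀ (K L : Type u) [AddCommGroup K] [Module Aᵐᵒᵖ K] [AddCommGroup L] [Module Aᵐᵒᵖ L]
    (ρK : Comodule 𝒞 K) (ρL : Comodule 𝒞 L) (i : K →ₗ[Aᵐᵒᵖ] L), IsColinear ρK ρL i →
    (∃ p : L →ₗ[Aᵐᵒᵖ] K, ∀ k, p (i k) = k) →
    ∀ f : K →ₗ[Aᵐᵒᵖ] N, IsColinear ρK ρN f →
      ∃ g : L →ₗ[Aᵐᵒᵖ] N, IsColinear ρL ρN g ∧ ∀ k, g (i k) = f k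

/-- `S` is an `R`-`𝒞` comonadic-Galois comodule: `can_M` is an isomorphism for all right
`A`-modules `M`. -/
def IsComonadicGalois {A R C S : Type u} [Ring A] [NonUnitalRing R] [AddCommGroup C] [Module A C]
    [Module Aᵐᵒᵖ C] [SMulCommClass A Aᵐᵒᵖ C] [AddCommGroup S] [Module Aᵐᵒᵖ S] [DistribSMul R S]
    [IsNonUnitalModule R S] [SMulCommClass R Aᵐᵒᵖ S] {𝒞 : Coring A C} (σ : Bicomodule R 𝒞 S) :
    Prop :=
  ∀ (M : Type u) [AddCommGroup M] [Module Aᵐᵒᵖ M], Function.Bijective (can σ M)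

end Galois

/-! The functor `M ↦ M ⊗_A C`, with coaction `M ⊗ Δ`, is right adjoint to forgetting the coaction:
`f ↦ (f ⊗ C) ∘ ρ` is an isomorphism `Hom_A(S, M) ≃ Hom^𝒞(S, M ⊗_A C)` with inverse `g ↦ (M ⊗ ε) ∘
g`. It is right `R`-linear because the coaction of `S` is left `R`-linear, and after applying `- ⊗_R
S` it carries `can_M` to `ev` at the cofree comodule `M ⊗_A C` (`Bicomodule.can_bijective_iff`). So
the Galois condition says exactly that `ev` is bijective at all cofree comodules.

Cofree comodules are `(𝒞, A)`-injective (`Coring.isRelInjective_cofree`), which gives one direction.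
Conversely, a `(𝒞, A)`-injective `N` is a colinear retract of `N ⊗_A C`, because its coaction is
colinear and split by `N ⊗ ε` (`IsRelInjective.exists_retraction`). Since `ev` is natural, its
bijectivity passes to retracts (`Bicomodule.ev_bijective_of_retract`). -/

namespace BalTensor

/-! ### Balanced tensor products: zero and equivalences. -/

theorem tmul_zero {S M N : Type*} [AddCommGroup M] [AddCommGroup N] [SMul Sᵐᵒᵖ M] [SMul S N]
    (m : M) : tmul S m (0 : N) = 0 :=
  map_zero (mk S M N m)

theorem zero_tmul {S M N : Type*} [AddCommGroup M] [AddCommGroup N] [SMul Sᵐᵒᵖ M] [SMul S N]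
    (n : N) : tmul S (0 : M) n = 0 :=
  map_zero ((mk S M N).flip n)

/-- Tensoring an additive equivalence of right `S`-modules with `N` is bijective. -/
theorem map_bijective_of_addEquiv {S M M' N : Type*} [AddCommGroup M] [AddCommGroup M']
    [AddCommGroup N] [SMul Sᵐᵒᵖ M] [SMul Sᵐᵒᵖ M'] [SMul S N] (e : M ≃+ M')
    (he : ∀ (s : S) m, e (op s • m) = op s • e m) :
    Function.Bijective
      (map e.toAddMonoidHom he (AddMonoidHom.id N) (fun (_ : S) _ => rfl)) := by
  have he' : ∀ (s : S) m, e.symm (op s • m) = op s • e.symm m := fun s m => by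
    rw [e.symm_apply_eq, he, e.apply_symm_apply]
  refine Function.bijective_iff_has_inverse.2
    ⟨map e.symm.toAddMonoidHom he' (AddMonoidHom.id N) (fun _ _ => rfl), fun x => ?_, fun x => ?_⟩
  · induction x using induction with
    | zero => rw [map_zero, map_zero]
    | pure m n => exact congrArg (tmul S · n) (e.symm_apply_apply m)
    | add x y hx hy => rw [map_add, map_add, hx, hy]
  · induction x using induction with
    | zero => rw [map_zero, map_zero]
    | pure m n => exact congrArg (tmul S · n) (e.apply_symm_apply m)
    | add x y hx hy => rw [map_add, map_add, hx, hy]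

end BalTensor

/-! ### Cofree comodules. -/

section Cofree

open BalTensor

variable {A C : Type*} [Ring A] [AddCommGroup C] [Module A C] [Module Aᵐᵒᵖ C]
  [SMulCommClass A Aᵐᵒᵖ C]

theorem tensorRight_comp {M N P : Type*} [AddCommGroup M] [Module Aᵐᵒᵖ M] [AddCommGroup N]
    [Module Aᵐᵒᵖ N] [AddCommGroup P] [Module Aᵐᵒᵖ P] (g : N →ₗ[Aᵐᵒᵖ] P) (f : M →ₗ[Aᵐᵒᵖ] N)
    (x : BalTensor A M C) : tensorRight g (tensorRight f x) = tensorRight (g.comp f) x := by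
  induction x using BalTensor.induction with
  | zero => simp only [map_zero]
  | pure m c => rfl
  | add x y hx hy => simp only [map_add, hx, hy]

theorem tensorRight_id {M : Type*} [AddCommGroup M] [Module Aᵐᵒᵖ M] (x : BalTensor A M C) :
    tensorRight (LinearMap.id : M →ₗ[Aᵐᵒᵖ] M) x = x := by
  induction x using BalTensor.induction with
  | zero => simp only [map_zero]
  | pure m c => rfl
  | add x y hx hy => simp only [map_add, hx, hy]

/-- `M ⊗ Δ : M ⊗_A C → M ⊗_A (C ⊗_A C)`. -/
def Coring.mapComul (𝒞 : Coring A C) (M : Type*) [AddCommGroup M] [Module Aᵐᵒᵖ M] :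
    BalTensor A M C →+ BalTensor A M (BalTensor A C C) :=
  BalTensor.map (AddMonoidHom.id M) (fun _ _ => rfl) 𝒞.comul.toAddMonoidHom 𝒞.comul_smul

theorem Coring.mapComul_tmul (𝒞 : Coring A C) {M : Type*} [AddCommGroup M] [Module Aᵐᵒᵖ M]
    (m : M) (c : C) : 𝒞.mapComul M (tmul A m c) = tmul A m (𝒞.comul c) := rfl

/-- `M ⊗ ε : M ⊗_A C → M`, `m ⊗ c ↦ m ε(c)`, as a map of right `A`-modules. -/
def Coring.counitRight (𝒞 : Coring A C) (M : Type*) [AddCommGroup M] [Module Aᵐᵒᵖ M] :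
    BalTensor A M C →ₗ[Aᵐᵒᵖ] M where
  __ := (rightAct A M).comp
    (BalTensor.map (AddMonoidHom.id M) (fun _ _ => rfl) 𝒞.counit.toAddMonoidHom 𝒞.counit_smul)
  map_smul' a x := by
    change rightAct A M (BalTensor.map _ _ _ _ (a • x)) =
      a • rightAct A M (BalTensor.map _ _ _ _ x)
    induction x using BalTensor.induction with
    | zero => simp only [smul_zero, map_zero]
    | pure m c =>
      change op (𝒞.counit (a • c)) • m = a • op (𝒞.counit c) • m
      -- `a` acts on `A` as right multiplication by `unop a`, so `op (a • ε c)` is `a * op (ε c)` by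
      -- definition.
      rw [map_smul, ← mul_smul]
      rfl
    | add x y hx hy => simp only [smul_add, map_add, hx, hy]

theorem Coring.counitRight_tmul (𝒞 : Coring A C) {M : Type*} [AddCommGroup M] [Module Aᵐᵒᵖ M]
    (m : M) (c : C) : 𝒞.counitRight M (tmul A m c) = op (𝒞.counit c) • m := rfl

theorem Comodule.counitRight_coact {𝒞 : Coring A C} {M : Type*} [AddCommGroup M] [Module Aᵐᵒᵖ M]
    (ρ : Comodule 𝒞 M) (m : M) : 𝒞.counitRight M (ρ.coact m) = m :=
  ρ.counit m

theorem Coring.counitRight_tensorRight (𝒞 : Coring A C) {M N : Type*} [AddCommGroup M]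
    [Module Aᵐᵒᵖ M] [AddCommGroup N] [Module Aᵐᵒᵖ N] (f : M →ₗ[Aᵐᵒᵖ] N) (x : BalTensor A M C) :
    𝒞.counitRight N (tensorRight f x) = f (𝒞.counitRight M x) := by
  induction x using BalTensor.induction with
  | zero => simp only [map_zero]
  | pure m c => rw [tensorRight_tmul, counitRight_tmul, counitRight_tmul, map_smul]
  | add x y hx hy => simp only [map_add, hx, hy]

/-- The coaction `M ⊗ Δ : M ⊗_A C → (M ⊗_A C) ⊗_A C` as a map of right `A`-modules. -/
def Coring.cofreeCoact (𝒞 : Coring A C) (M : Type*) [AddCommGroup M] [Module Aᵐᵒᵖ M] :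
    BalTensor A M C →ₗ[Aᵐᵒᵖ] BalTensor A (BalTensor A M C) C where
  __ := (assocInv A M C C).comp (𝒞.mapComul M)
  map_smul' a x := by
    change assocInv A M C C (𝒞.mapComul M (a • x)) = a • assocInv A M C C (𝒞.mapComul M x)
    induction x using BalTensor.induction with
    | zero => simp only [smul_zero, map_zero]
    | pure m c =>
      rw [right_smul_tmul, 𝒞.mapComul_tmul, 𝒞.mapComul_tmul, map_smul]
      -- `Δ c` is not a pure tensor, but the identity holds for every element of `C ⊗_A C`, where
      -- induction applies.
      generalize 𝒞.comul c = y
      induction y using BalTensor.induction with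
      | zero => simp only [smul_zero, tmul_zero, map_zero]
      | pure p q => rfl
      | add x y hx hy => simp only [smul_add, tmul_add, map_add, hx, hy]
    | add x y hx hy => simp only [smul_add, map_add, hx, hy]

theorem Coring.cofreeCoact_tmul (𝒞 : Coring A C) {M : Type*} [AddCommGroup M] [Module Aᵐᵒᵖ M]
    (m : M) (c : C) :
    𝒞.cofreeCoact M (tmul A m c) = assocInv A M C C (tmul A m (𝒞.comul c)) := rfl

/-- This lemma and the next two let an arbitrary `y` stand for `Δ c`, so that pure tensors suffice.
They move each map in the comodule axioms for `M ⊗_A C` past `m`, which reduces those axioms to the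
ones for `C`. -/
theorem Coring.assoc_tensorRight_cofreeCoact (𝒞 : Coring A C) {M : Type*} [AddCommGroup M]
    [Module Aᵐᵒᵖ M] (m : M) (y : BalTensor A C C) :
    assoc A (BalTensor A M C) C C
        (tensorRight (𝒞.cofreeCoact M) (assocInv A M C C (tmul A m y)))
      = assocInv A M C (BalTensor A C C) (tmul A m (assoc A C C C (tensorRight 𝒞.comul y))) := by
  induction y using BalTensor.induction with
  | zero => simp only [tmul_zero, map_zero]
  | pure a b =>
    rw [assocInv_tmul, tensorRight_tmul, tensorRight_tmul, 𝒞.cofreeCoact_tmul]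
    generalize 𝒞.comul a = z
    induction z using BalTensor.induction with
    | zero => simp only [tmul_zero, zero_tmul, map_zero]
    | pure p q => rfl
    | add x y hx hy => simp only [tmul_add, add_tmul, map_add, hx, hy]
  | add x y hx hy => simp only [tmul_add, map_add, hx, hy]

theorem Coring.mapComul_assocInv (𝒞 : Coring A C) {M : Type*} [AddCommGroup M] [Module Aᵐᵒᵖ M]
    (m : M) (y : BalTensor A C C) :
    𝒞.mapComul (BalTensor A M C) (assocInv A M C C (tmul A m y))
      = assocInv A M C (BalTensor A C C) (tmul A m (𝒞.mapComul C y)) := by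
  induction y using BalTensor.induction with
  | zero => simp only [tmul_zero, map_zero]
  | pure a b => rfl
  | add x y hx hy => simp only [tmul_add, map_add, hx, hy]

theorem Coring.counitRight_assocInv (𝒞 : Coring A C) {M : Type*} [AddCommGroup M]
    [Module Aᵐᵒᵖ M] (m : M) (y : BalTensor A C C) :
    𝒞.counitRight (BalTensor A M C) (assocInv A M C C (tmul A m y))
      = tmul A m (𝒞.counitRight C y) := by
  induction y using BalTensor.induction with
  | zero => simp only [tmul_zero, map_zero]
  | pure a b => rfl
  | add x y hx hy => simp only [tmul_add, map_add, hx, hy]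

/-- The cofree comodule `M ⊗_A C`. -/
def Coring.cofree (𝒞 : Coring A C) (M : Type*) [AddCommGroup M] [Module Aᵐᵒᵖ M] :
    Comodule 𝒞 (BalTensor A M C) where
  coact := 𝒞.cofreeCoact M
  coassoc x := by
    change _ = 𝒞.mapComul (BalTensor A M C) _
    induction x using BalTensor.induction with
    | zero => simp only [map_zero]
    | pure m c =>
      rw [𝒞.cofreeCoact_tmul, 𝒞.assoc_tensorRight_cofreeCoact, 𝒞.mapComul_assocInv]
      exact congrArg (fun z => assocInv A M C (BalTensor A C C) (tmul A m z)) (𝒞.coassoc c)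
    | add x y hx hy => simp only [map_add, hx, hy]
  counit x := by
    change 𝒞.counitRight (BalTensor A M C) _ = _
    induction x using BalTensor.induction with
    | zero => simp only [map_zero]
    | pure m c =>
      rw [𝒞.cofreeCoact_tmul, 𝒞.counitRight_assocInv]
      exact congrArg (tmul A m) (𝒞.comul_counit c)
    | add x y hx hy => simp only [map_add, hx, hy]

/-- A triangle identity of the adjunction. Here `ε` meets the first factor of `Δ c`, so the law
needed is `counit_comul`, whereas the counit axiom of `cofree` rests on `comul_counit`. -/
theorem Coring.tensorRight_counitRight_cofreeCoact (𝒞 : Coring A C) {M : Type*} [AddCommGroup M]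
    [Module Aᵐᵒᵖ M] (x : BalTensor A M C) :
    tensorRight (𝒞.counitRight M) (𝒞.cofreeCoact M x) = x := by
  have key : ∀ (m : M) (y : BalTensor A C C),
      tensorRight (𝒞.counitRight M) (assocInv A M C C (tmul A m y))
        = tmul A m (leftAct A C (BalTensor.map 𝒞.counit.toAddMonoidHom
            (fun a c => 𝒞.counit.map_smul (op a) c) (AddMonoidHom.id C) (fun _ _ => rfl) y)) := by
    intro m y
    induction y using BalTensor.induction with
    | zero => simp only [tmul_zero, map_zero]
    | pure a b =>
      rw [assocInv_tmul, tensorRight_tmul, 𝒞.counitRight_tmul]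
      -- Balancing: `m ε(a) ⊗ b = m ⊗ ε(a) b`.
      exact smul_tmul (𝒞.counit a) m b
    | add x y hx hy => simp only [tmul_add, map_add, hx, hy]
  induction x using BalTensor.induction with
  | zero => simp only [map_zero]
  | pure m c => rw [𝒞.cofreeCoact_tmul, key, 𝒞.counit_comul]
  | add x y hx hy => simp only [map_add, hx, hy]

/-- The coextension `(f ⊗ C) ∘ ρ : K → M ⊗_A C` of a right `A`-linear map `f : K → M`. -/
def Comodule.coextend {𝒞 : Coring A C} {K M : Type*} [AddCommGroup K] [Module Aᵐᵒᵖ K]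
    [AddCommGroup M] [Module Aᵐᵒᵖ M] (ρ : Comodule 𝒞 K) (f : K →ₗ[Aᵐᵒᵖ] M) :
    K →ₗ[Aᵐᵒᵖ] BalTensor A M C :=
  (tensorRight f).comp ρ.coact

/-! ### The adjunction between forgetting the coaction and the cofree comodule. -/

section Adjunction

variable {𝒞 : Coring A C} {K M : Type*} [AddCommGroup K] [Module Aᵐᵒᵖ K]
  [AddCommGroup M] [Module Aᵐᵒᵖ M] (ρ : Comodule 𝒞 K)

/-- This is coassociativity of `ρ`; applying the associator cancels the `assocInv` built into
`cofreeCoact`. -/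
theorem Comodule.isColinear_coact : IsColinear ρ (𝒞.cofree K) ρ.coact := fun k =>
  (assoc A K C C).injective <|
    (assocHom_assocInv A K C C (𝒞.mapComul K (ρ.coact k))).trans (ρ.coassoc k).symm

theorem Coring.isColinear_tensorRight (𝒞 : Coring A C) {N : Type*} [AddCommGroup N]
    [Module Aᵐᵒᵖ N] (f : N →ₗ[Aᵐᵒᵖ] M) :
    IsColinear (𝒞.cofree N) (𝒞.cofree M) (tensorRight f) := by
  intro x
  change 𝒞.cofreeCoact M (tensorRight f x) = tensorRight (tensorRight f) (𝒞.cofreeCoact N x)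
  induction x using BalTensor.induction with
  | zero => simp only [map_zero]
  | pure m c =>
    rw [tensorRight_tmul, 𝒞.cofreeCoact_tmul, 𝒞.cofreeCoact_tmul]
    generalize 𝒞.comul c = y
    induction y using BalTensor.induction with
    | zero => simp only [tmul_zero, map_zero]
    | pure p q => rfl
    | add x y hx hy => simp only [tmul_add, map_add, hx, hy]
  | add x y hx hy => simp only [map_add, hx, hy]

theorem IsColinear.comp {L N : Type*} [AddCommGroup L] [Module Aᵐᵒᵖ L] [AddCommGroup N]
    [Module Aᵐᵒᵖ N] {ρK : Comodule 𝒞 K} {ρL : Comodule 𝒞 L} {ρN : Comodule 𝒞 N}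
    {g : L →ₗ[Aᵐᵒᵖ] N} {f : K →ₗ[Aᵐᵒᵖ] L} (hg : IsColinear ρL ρN g) (hf : IsColinear ρK ρL f) :
    IsColinear ρK ρN (g.comp f) := fun k => by
  rw [LinearMap.comp_apply, hg, hf, tensorRight_comp]

theorem Comodule.isColinear_coextend (f : K →ₗ[Aᵐᵒᵖ] M) :
    IsColinear ρ (𝒞.cofree M) (ρ.coextend f) :=
  (𝒞.isColinear_tensorRight f).comp ρ.isColinear_coact

/-- By naturality of `M ⊗ ε`, the map `f` can be pulled out, and the counit axiom of `ρ` cancels the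
coaction. -/
theorem Comodule.counitRight_coextend (f : K →ₗ[Aᵐᵒᵖ] M) (k : K) :
    𝒞.counitRight M (ρ.coextend f k) = f k :=
  (𝒞.counitRight_tensorRight f (ρ.coact k)).trans (congrArg f (ρ.counitRight_coact k))

/-- Colinearity replaces `(g ⊗ C) ∘ ρ` by the cofree coaction after `g`; the triangle identity then
removes `M ⊗ ε`. -/
theorem Comodule.coextend_counitRight {g : K →ₗ[Aᵐᵒᵖ] BalTensor A M C}
    (hg : IsColinear ρ (𝒞.cofree M) g) : ρ.coextend ((𝒞.counitRight M).comp g) = g := by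
  ext k
  change tensorRight ((𝒞.counitRight M).comp g) (ρ.coact k) = g k
  rw [← tensorRight_comp, ← hg k]
  exact 𝒞.tensorRight_counitRight_cofreeCoact (g k)

end Adjunction

/-! ### Comparing `can` with `ev`, and retracts. -/

section Galois

variable {R S M : Type*} [NonUnitalRing R] [AddCommGroup S] [Module Aᵐᵒᵖ S] [DistribSMul R S]
  [IsNonUnitalModule R S] [SMulCommClass R Aᵐᵒᵖ S] [AddCommGroup M] [Module Aᵐᵒᵖ M]
  {𝒞 : Coring A C} (σ : Bicomodule R 𝒞 S)

/-- The adjunction isomorphism `Hom_A(S, M) ≃ Hom^𝒞(S, M ⊗_A C)`. -/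
def Bicomodule.homAEquivHomC (M : Type*) [AddCommGroup M] [Module Aᵐᵒᵖ M] :
    HomA A S M ≃+ HomC σ (𝒞.cofree M) where
  toFun f := ⟨σ.coextend f, σ.isColinear_coextend f⟩
  invFun g := (𝒞.counitRight M).comp g.1
  left_inv f := LinearMap.ext (σ.counitRight_coextend f)
  right_inv g := Subtype.ext (σ.coextend_counitRight g.2)
  map_add' f g := Subtype.ext (LinearMap.ext fun u => tensorRight_add f g (σ.coact u))

/-- Needed to tensor the adjunction with `S` over `R`; it holds because the coaction of `S` is left
`R`-linear. -/
theorem Bicomodule.homAEquivHomC_smul (r : R) (f : HomA A S M) :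
    σ.homAEquivHomC M (op r • f) = op r • σ.homAEquivHomC M f :=
  Subtype.ext <| LinearMap.ext fun u =>
    (tensorRight_precompSMul r f (σ.coact u)).trans
      (congrArg (tensorRight (f : S →ₗ[Aᵐᵒᵖ] M)) (σ.coact_smul r u).symm)

/-- `can_M` is `ev` composed with the adjunction isomorphism tensored with `S`: both send `f ⊗ u` to
`(f ⊗ C)(ρ u)`. -/
theorem Bicomodule.can_bijective_iff (M : Type*) [AddCommGroup M] [Module Aᵐᵒᵖ M] :
    Function.Bijective (can σ M) ↔ Function.Bijective (ev σ (𝒞.cofree M)) := by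
  have h := map_bijective_of_addEquiv (S := R) (N := S) (σ.homAEquivHomC M) σ.homAEquivHomC_smul
  rw [← Function.Bijective.of_comp_iff _ h]
  refine iff_of_eq (congrArg _ (funext fun x => ?_))
  rw [Function.comp_apply]
  induction x using BalTensor.induction with
  | zero => simp only [map_zero]
  | pure f u => rfl
  | add x y hx hy => simp only [map_add, hx, hy]

/-- Postcomposition `Hom^𝒞(S, M) ⊗_R S → Hom^𝒞(S, N) ⊗_R S` with a colinear map `M → N`. -/
def Bicomodule.mapHomC {N : Type*} [AddCommGroup N] [Module Aᵐᵒᵖ N] {ρM : Comodule 𝒞 M}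
    {ρN : Comodule 𝒞 N} {g : M →ₗ[Aᵐᵒᵖ] N} (hg : IsColinear ρM ρN g) :
    BalTensor R (HomC σ ρM) S →+ BalTensor R (HomC σ ρN) S :=
  BalTensor.map
    (AddMonoidHom.mk' (fun f : HomC σ ρM => (⟨g.comp f.1, hg.comp f.2⟩ : HomC σ ρN))
      (fun f f' => Subtype.ext (LinearMap.comp_add f.1 f'.1 g)))
    (fun _ _ => rfl) (AddMonoidHom.id S) (fun _ _ => rfl)

theorem Bicomodule.ev_mapHomC {N : Type*} [AddCommGroup N] [Module Aᵐᵒᵖ N] {ρM : Comodule 𝒞 M}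
    {ρN : Comodule 𝒞 N} {g : M →ₗ[Aᵐᵒᵖ] N} (hg : IsColinear ρM ρN g)
    (x : BalTensor R (HomC σ ρM) S) : ev σ ρN (σ.mapHomC hg x) = g (ev σ ρM x) := by
  induction x using BalTensor.induction with
  | zero => simp only [map_zero]
  | pure f u => rfl
  | add x y hx hy => simp only [map_add, hx, hy]

/-- Bijectivity of the evaluation map passes to colinear retracts. -/
theorem Bicomodule.ev_bijective_of_retract {N : Type*} [AddCommGroup N] [Module Aᵐᵒᵖ N]
    {ρM : Comodule 𝒞 M} {ρN : Comodule 𝒞 N} {i : M →ₗ[Aᵐᵒᵖ] N} {p : N →ₗ[Aᵐᵒᵖ] M}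
    (hi : IsColinear ρM ρN i) (hp : IsColinear ρN ρM p) (hpi : ∀ m, p (i m) = m)
    (hN : Function.Bijective (ev σ ρN)) : Function.Bijective (ev σ ρM) := by
  have hmap : ∀ x, σ.mapHomC hp (σ.mapHomC hi x) = x := fun x => by
    induction x using BalTensor.induction with
    | zero => simp only [map_zero]
    | pure f u =>
      exact congrArg (tmul R · u) (Subtype.ext (LinearMap.ext fun v => hpi (f.1 v)))
    | add x y hx hy => simp only [map_add, hx, hy]
  -- By naturality `ev_M` is a retract of `ev_N`. Injectivity is tested after pushing along `i`; a
  -- preimage of `m` is a preimage of `i m` pushed along `p`.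
  refine ⟨fun x y hxy => ?_, fun m => ?_⟩
  · rw [← hmap x, ← hmap y]
    refine congrArg _ (hN.1 ?_)
    rw [σ.ev_mapHomC, σ.ev_mapHomC, hxy]
  · obtain ⟨z, hz⟩ := hN.2 (i m)
    exact ⟨σ.mapHomC hp z, by rw [σ.ev_mapHomC, hz, hpi]⟩

end Galois

end Cofree

/-! ### Relative injectivity and cofree comodules. -/

section RelInjective

variable {A C : Type u} [Ring A] [AddCommGroup C] [Module A C] [Module Aᵐᵒᵖ C]
  [SMulCommClass A Aᵐᵒᵖ C]

theorem Coring.isRelInjective_cofree (𝒞 : Coring A C) (M : Type u) [AddCommGroup M]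
    [Module Aᵐᵒᵖ M] : IsRelInjective (𝒞.cofree M) := by
  intro K L _ _ _ _ ρK ρL i hi ⟨p, hp⟩ f hf
  -- Under the adjunction `f` corresponds to the `A`-linear map `(M ⊗ ε) ∘ f`. Composing with the
  -- `A`-linear splitting `p` extends it to `L`, and coextension makes the result colinear.
  refine ⟨ρL.coextend (((𝒞.counitRight M).comp f).comp p), ρL.isColinear_coextend _, fun k => ?_⟩
  change tensorRight _ (ρL.coact (i k)) = f k
  rw [hi, tensorRight_comp, LinearMap.comp_assoc,
    show p.comp i = LinearMap.id from LinearMap.ext hp, LinearMap.comp_id]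
  exact LinearMap.congr_fun (ρK.coextend_counitRight hf) k

/-- A `(𝒞, A)`-injective comodule is a colinear retract of its cofree comodule. -/
theorem IsRelInjective.exists_retraction {𝒞 : Coring A C} {N : Type u} [AddCommGroup N]
    [Module Aᵐᵒᵖ N] {ρ : Comodule 𝒞 N} (h : IsRelInjective ρ) :
    ∃ p : BalTensor A N C →ₗ[Aᵐᵒᵖ] N, IsColinear (𝒞.cofree N) ρ p ∧ ∀ n, p (ρ.coact n) = n :=
  -- The identity of `N` is extended along the coaction, whose `A`-linear left inverse is `N ⊗ ε`.
  h N (BalTensor A N C) ρ (𝒞.cofree N) ρ.coact ρ.isColinear_coact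
    ⟨𝒞.counitRight N, ρ.counitRight_coact⟩ LinearMap.id fun n => by
      rw [LinearMap.id_apply, tensorRight_id]

end RelInjective

theorem theorem3p3 {A R C S : Type u} [Ring A] [NonUnitalRing R]
    [AddCommGroup C] [Module A C] [Module Aᵐᵒᵖ C] [SMulCommClass A Aᵐᵒᵖ C]
    [AddCommGroup S] [Module Aᵐᵒᵖ S] [DistribSMul R S] [IsNonUnitalModule R S]
    [SMulCommClass R Aᵐᵒᵖ S]
    (hR : IsFirmRing R) (hS : IsFirmModule R S)
    (𝒞 : Coring A C) (σ : Bicomodule R 𝒞 S) :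
    IsComonadicGalois σ ↔
      ∀ (N : Type u) [AddCommGroup N] [Module Aᵐᵒᵖ N] (ρ : Comodule 𝒞 N),
        IsRelInjective ρ → Function.Bijective (ev σ ρ) := by
  constructor
  · intro hσ N _ _ ρ hρ
    obtain ⟨p, hp, hpi⟩ := hρ.exists_retraction
    -- The Galois condition is used at the underlying `A`-module of `N` itself.
    exact σ.ev_bijective_of_retract ρ.isColinear_coact hp hpi ((σ.can_bijective_iff N).1 (hσ N))
  · intro h M _ _
    exact (σ.can_bijective_iff M).2 (h _ _ (𝒞.isRelInjective_cofree M))
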